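/- Let $k\ge 2$, let $\Gamma=F(A_1,\dots,A_k)$ be the free group on $k$ generators, and put $q=2k-1$ and $\sigma^2=(k-1)^{-1}$. Let $\Gamma_c\subset\Gamma$ be the set of cyclically reduced words, that is, of elements whose reduced word does not begin and end with mutually inverse letters, and let $\mathrm{wl}(\gamma)$ be the word length of $\gamma$. Let $\Phi=(\log_1,\dots,\log_k):\Gamma\to\mathbb Z^k$ be the homomorphism with $\log_j(A_i)=\delta_{ij}$. For $\beta\in\mathbb Z^k$ and $m\in\mathbb N$ put $$n_{\Gamma,\beta}(m)=\#\{\gamma\in\Gamma_c : \mathrm{wl}(\gamma)=m,\ \Phi(\gamma)=\beta\},\qquad N_{\Gamma,\beta}(m)=\#\{\gamma\in\Gamma_c : \mathrm{wl}(\gamma)\le m,\ \Phi(\gamma)=\beta\},$$ and $s_{m,\beta}=1+(-1)^{m+\beta_1+\cdots+\beta_k}$, and let $\langle\beta,\beta\rangle=\beta_1^2+\cdots+\beta_k^2$. Then, as $m\to\infty$, $$\sup_{\beta\in\mathbb Z^k}\left|m^{k/2}\frac{n_{\Gamma,\beta}(m)}{q^m}-\frac{s_{m,\beta}}{(2\pi\sigma^2)^{k/2}}e^{-\langle\beta,\beta\rangle/(2\sigma^2m)}\right|=o(1)$$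 and $$\sup_{\beta\in\mathbb Z^k}\left|\frac{m^{k/2}}{2}\left(\frac{N_{\Gamma,\beta}(m)}{q^{m+1}/(q-1)}+\frac{N_{\Gamma,\beta}(m+1)}{q^{m+2}/(q-1)}\right)-\frac{1}{(2\pi\sigma^2)^{k/2}}e^{-\langle\beta,\beta\rangle/(2\sigma^2m)}\right|=o(1).$$ -/

import Mathlib

namespace FreeGroupCount

/-- The discrete logarithm `log_j` on the free group on `A_0, …, A_{k-1}`: the homomorphism to the
additive group `ℤ` with `A_i ↦ δ_{ij}`. -/
def discreteLog {k : ℕ} (j : Fin k) : FreeGroup (Fin k) →* Multiplicative ℤ :=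
  FreeGroup.lift fun i => Multiplicative.ofAdd (if i = j then (1 : ℤ) else 0)

/-- The vector of discrete logarithms `Φ(γ) = (log_0 γ, …, log_{k-1} γ)`. -/
def Phi {k : ℕ} (γ : FreeGroup (Fin k)) : Fin k → ℤ :=
  fun j => Multiplicative.toAdd (discreteLog j γ)

/-- The elements of the free group whose reduced word is cyclically reduced. -/
def cyclicallyReduced (k : ℕ) : Set (FreeGroup (Fin k)) :=
  {γ | FreeGroup.IsCyclicallyReduced γ.toWord}

/-- There are only finitely many elements of bounded word length, so that the cardinalities
below are those of finite sets. -/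
theorem finite_norm_le (k m : ℕ) : {γ : FreeGroup (Fin k) | γ.norm ≤ m}.Finite :=
  (List.finite_length_le (Fin k × Bool) m).preimage FreeGroup.toWord_injective.injOn

/-- `n_β(m)`: the number of cyclically reduced words `γ` of word length `m` with `Φ(γ) = β`. -/
noncomputable def n {k : ℕ} (β : Fin k → ℤ) (m : ℕ) : ℕ :=
  {γ : FreeGroup (Fin k) | γ ∈ cyclicallyReduced k ∧ γ.norm = m ∧ Phi γ = β}.ncard

/-- `N_β(m)`: the number of cyclically reduced words `γ` of word length at most `m` with
`Φ(γ) = β`. -/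
noncomputable def N {k : ℕ} (β : Fin k → ℤ) (m : ℕ) : ℕ :=
  {γ : FreeGroup (Fin k) | γ ∈ cyclicallyReduced k ∧ γ.norm ≤ m ∧ Phi γ = β}.ncard

/-- `q = 2k - 1`. -/
def q (k : ℕ) : ℝ := 2 * (k : ℝ) - 1

/-- The variance `σ² = (k - 1)⁻¹`. -/
noncomputable def sigmaSq (k : ℕ) : ℝ := ((k : ℝ) - 1)⁻¹

/-- The parity factor `s_{m,β} = 1 + (-1)^(m + β_1 + ⋯ + β_k)`. -/
noncomputable def s {k : ℕ} (m : ℕ) (β : Fin k → ℤ) : ℝ :=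
  1 + (-1 : ℝ) ^ ((m : ℤ) + ∑ j, β j)

/-- The Gaussian term `(2πσ²)^(-k/2) exp(-⟨β, β⟩ / (2σ²m))`. -/
noncomputable def gaussian {k : ℕ} (m : ℕ) (β : Fin k → ℤ) : ℝ :=
  Real.exp (-(∑ j, (β j : ℝ) ^ 2) / (2 * sigmaSq k * (m : ℝ))) /
    (2 * Real.pi * sigmaSq k) ^ ((k : ℝ) / 2)

end FreeGroupCount

/-! Give each letter a unitary weight `z`, with `z a * z (letterInv a) = 1`. The trace of the `m`-th
power of the transfer matrix `T` of reduced words is then, for `m ≥ 1`, the weighted sum over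
cyclically reduced words of length `m`, so `n β m` is a Fourier coefficient of this trace on the
torus.

The vectors `z` and `1` span a plane stable under `T`, on which `T` has characteristic polynomial
`X² - A X + q` with `A = ∑ a, z a`. Modulo that plane `T² = 1`. Hence the trace is a Dickson
polynomial in `A`, the power sum of the two roots, plus the bounded term `(k - 1)(1 + (-1)^m)`
(`trace_transfer_pow`).

Here `A` is twice a sum `t` of `k` cosines, and the Dickson term is largest at `t = ±k`. Translation
by the half-point exchanges the two peaks and produces the parity factor `s` (`integral_mainChar`).
At `t = k` the roots are `q` and `1`, and the larger has logarithmic derivative `1/(k - 1) = σ²`. At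
scale `m^(-1/2)` the integrand divided by `q^m` therefore tends to a Gaussian
(`tendsto_mainChar_div`), while `exists_abs_mainChar_le` supplies a dominating function. Convergence
in `L¹` gives errors uniform in `β` (`exists_local_limit`).

For `N`, the normalised average of two consecutive values obeys a recursion with factor tending to
`1/q < 1`, whose forcing term averages out the parity. The Gaussian is an approximate solution, so
the error contracts to zero. -/

namespace FreeGroupCount

/-! ### Dickson polynomials as power sums -/

/-- Two-step recurrence for evaluations of Dickson polynomials of the first kind. -/
theorem dickson_eval_add_two {R : Type*} [CommRing R] (a x : R) (m : ℕ) :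
    (Polynomial.dickson 1 a (m + 2)).eval x
      = x * (Polynomial.dickson 1 a (m + 1)).eval x - a * (Polynomial.dickson 1 a m).eval x := by
  simp

theorem dickson_eval_zero {R : Type*} [CommRing R] (a x : R) :
    (Polynomial.dickson 1 a 0).eval x = 2 := by
  simp; norm_num

/-- Dickson polynomials of the first kind are power sums of two elements. -/
theorem dickson_eval_add {R : Type*} [CommRing R] (x y : R) (m : ℕ) :
    (Polynomial.dickson 1 (x * y) m).eval (x + y) = x ^ m + y ^ m := by
  induction m using Nat.twoStepInduction with
  | zero => rw [dickson_eval_zero]; norm_num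
  | one => simp
  | more m h1 h2 => rw [dickson_eval_add_two, h1, h2]; ring

theorem dickson_eval_neg {R : Type*} [CommRing R] (a x : R) (m : ℕ) :
    (Polynomial.dickson 1 a m).eval (-x) = (-1) ^ m * (Polynomial.dickson 1 a m).eval x := by
  induction m using Nat.twoStepInduction with
  | zero => simp
  | one => simp
  | more m h1 h2 => rw [dickson_eval_add_two, dickson_eval_add_two, h1, h2]; ring

theorem dickson_eval_map {R S : Type*} [CommRing R] [CommRing S] (f : R →+* S) (a x : R) (m : ℕ) :
    (Polynomial.dickson 1 (f a) m).eval (f x) = f ((Polynomial.dickson 1 a m).eval x) := by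
  rw [← Polynomial.map_dickson, Polynomial.eval_map_apply]

/-! ### The transfer matrix and the traces of its powers -/

section Transfer

open Matrix

variable {k : ℕ} {R : Type*} [CommRing R]

/-- The inverse of a letter. -/
def letterInv (a : Fin k × Bool) : Fin k × Bool := (a.1, !a.2)

@[simp] theorem letterInv_letterInv (a : Fin k × Bool) : letterInv (letterInv a) = a := by
  simp [letterInv]

theorem letterInv_ne (a : Fin k × Bool) : letterInv a ≠ a := by
  simp [letterInv, Prod.ext_iff]

theorem sum_letterInv (f : Fin k × Bool → R) : ∑ a, f (letterInv a) = ∑ a, f a :=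
  Equiv.sum_comp ⟨letterInv, letterInv, letterInv_letterInv, letterInv_letterInv⟩ f

/-- The weighted transfer matrix of reduced words. -/
def transfer (z : Fin k × Bool → R) : Matrix (Fin k × Bool) (Fin k × Bool) R :=
  fun a b => if b = letterInv a then 0 else z a

theorem transfer_mulVec (z v : Fin k × Bool → R) (a : Fin k × Bool) :
    (transfer z *ᵥ v) a = z a * ∑ b, v b - z a * v (letterInv a) := by
  have : ∀ b, transfer z a b * v b = z a * v b - if b = letterInv a then z a * v b else 0 := by
    intro b; unfold transfer; split_ifs <;> simp
  simp only [mulVec, dotProduct, this, Finset.sum_sub_distrib, Finset.mul_sum]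
  simp

/-- With `transfer_mulVec_one` this makes the span of `z` and `1` invariant, with trace `∑ a, z a`
and determinant `2k - 1`. -/
theorem transfer_mulVec_weight (z : Fin k × Bool → R) (hz : ∀ a, z a * z (letterInv a) = 1) :
    transfer z *ᵥ z = (∑ a, z a) • z - 1 := by
  ext a
  rw [transfer_mulVec, hz]
  simp [mul_comm]

theorem transfer_mulVec_one (z : Fin k × Bool → R) :
    transfer z *ᵥ 1 = (2 * k - 1 : R) • z := by
  ext a
  rw [transfer_mulVec]
  simp
  ring

/-- The matrix is `z 1ᵀ - D J`, with `D` diagonal with entries `z` and `J` the permutation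
`letterInv`. The hypothesis gives `(D J)² = 1`, and all other products have rank one with image in
the span of `z` and `1`. -/
theorem transfer_mul_self (z : Fin k × Bool → R) (hz : ∀ a, z a * z (letterInv a) = 1) :
    transfer z * transfer z = 1 + vecMulVec z ((∑ a, z a) • 1 - z ∘ letterInv)
      - vecMulVec 1 1 := by
  refine Matrix.toLin'.injective (LinearMap.ext fun v => funext fun a => ?_)
  have h1 : ∀ v : Fin k × Bool → R, ∑ b, (transfer z *ᵥ v) b
      = (∑ b, z b) * ∑ b, v b - ∑ b, z (letterInv b) * v b := by
    intro v
    simp only [transfer_mulVec, Finset.sum_sub_distrib, Finset.sum_mul]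
    congr 1
    rw [← sum_letterInv]; simp
  simp only [toLin'_apply, sub_mulVec, add_mulVec, one_mulVec, Pi.sub_apply, Pi.add_apply,
    ← mulVec_mulVec, vecMulVec_mulVec]
  rw [transfer_mulVec, h1, transfer_mulVec]
  simp only [dotProduct, Pi.sub_apply, Pi.smul_apply, Pi.one_apply, Function.comp, smul_eq_mul,
    sub_mul, Finset.sum_sub_distrib, mul_one, ← Finset.mul_sum, MulOpposite.op_sub,
    sub_smul, MulOpposite.smul_eq_mul_unop, MulOpposite.unop_op, one_mul, letterInv_letterInv]
  linear_combination (v a - ∑ b, v b) * hz a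

theorem trace_transfer (z : Fin k × Bool → R) : (transfer z).trace = ∑ a, z a := by
  simp [trace, transfer, (letterInv_ne _).symm]

theorem trace_transfer_pow_add_two (z : Fin k × Bool → R) (hz : ∀ a, z a * z (letterInv a) = 1)
    (m : ℕ) : (transfer z ^ (m + 2)).trace = (transfer z ^ m).trace
      + (((∑ a, z a) • 1 - z ∘ letterInv) ⬝ᵥ (transfer z ^ m *ᵥ z) - 1 ⬝ᵥ (transfer z ^ m *ᵥ 1)) := by
  rw [pow_add, sq, transfer_mul_self z hz, mul_sub, mul_add, mul_one, trace_sub, trace_add,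
    mul_vecMulVec, mul_vecMulVec, trace_vecMulVec, trace_vecMulVec, dotProduct_comm,
    dotProduct_comm _ 1]
  ring

/-- **Ihara's formula for a bouquet**: traces of powers of the transfer matrix. -/
theorem trace_transfer_pow (z : Fin k × Bool → R) (hz : ∀ a, z a * z (letterInv a) = 1) (m : ℕ) :
    (transfer z ^ m).trace = (Polynomial.dickson 1 (2 * k - 1 : R) m).eval (∑ a, z a)
      + (k - 1) * (1 + (-1) ^ m) := by
  set A := ∑ a, z a with hA
  set q : R := 2 * k - 1 with hq
  set D : ℕ → R := fun m => (Polynomial.dickson 1 q m).eval A with hD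
  have hDrec : ∀ m, D (m + 2) = A * D (m + 1) - q * D m := fun m => dickson_eval_add_two _ _ _
  have hD0 : D 0 = 2 := dickson_eval_zero _ _
  have hD1 : D 1 = A := by simp [hD]
  set x : ℕ → Fin k × Bool → R := fun m => transfer z ^ m *ᵥ z with hx
  set y : ℕ → Fin k × Bool → R := fun m => transfer z ^ m *ᵥ 1 with hy
  have hx1 : ∀ m, x (m + 1) = A • x m - y m := by
    intro m
    simp only [hx, hy, pow_succ, ← mulVec_mulVec, transfer_mulVec_weight z hz, mulVec_sub,
      mulVec_smul, hA]
  have hy1 : ∀ m, y (m + 1) = q • x m := by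
    intro m
    simp only [hx, hy, pow_succ, ← mulVec_mulVec, transfer_mulVec_one, mulVec_smul, hq]
  -- `U m` is the increment of the trace from `m` to `m + 2`. It inherits the Dickson recurrence
  -- from the orbits `x` and `y`, so comparison with `D (m + 2) - D m` at `m = 0, 1` suffices.
  set U : ℕ → R := fun m => (A • 1 - z ∘ letterInv) ⬝ᵥ x m - 1 ⬝ᵥ y m with hU
  have hx0 : x 0 = z := by simp [hx]
  have hy0 : y 0 = 1 := by simp [hy]
  have e1 : (1 : Fin k × Bool → R) ⬝ᵥ z = A := by simp [hA, dotProduct]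
  have e2 : (1 : Fin k × Bool → R) ⬝ᵥ 1 = 2 * k := by simp; ring
  have e3 : (z ∘ letterInv) ⬝ᵥ z = 2 * k := by
    simp only [dotProduct, Function.comp, mul_comm (z (letterInv _)), hz]; simp; ring
  have e4 : (z ∘ letterInv) ⬝ᵥ 1 = A := by
    simp only [dotProduct, Function.comp, Pi.one_apply, mul_one, sum_letterInv, hA]
  have hUrec : ∀ m, U (m + 2) = A * U (m + 1) - q * U m := by
    intro m
    simp only [hU, hx1, hy1, dotProduct_sub, dotProduct_smul, sub_dotProduct, smul_dotProduct,
      smul_eq_mul]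
    ring
  have hUD : ∀ m, U m = D (m + 2) - D m := by
    intro m
    induction m using Nat.twoStepInduction with
    | zero =>
      simp only [hU, hx0, hy0, sub_dotProduct, smul_dotProduct, smul_eq_mul, e1, e2, e3, hDrec,
        hD0, zero_add, hD1, hq]
      ring
    | one =>
      simp only [hU, hx1, hy1, hx0, hy0, sub_dotProduct, smul_dotProduct, dotProduct_sub,
        dotProduct_smul, smul_eq_mul, e1, e2, e3, e4, hDrec, hD0, hD1,
        zero_add, Nat.reduceAdd, hq]
      ring
    | more m h1 h2 =>
      rw [hUrec, h1, h2, hDrec (m + 2), hDrec m]; ring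
  induction m using Nat.twoStepInduction with
  | zero =>
    change _ = D 0 + _
    rw [hD0]; simp; ring
  | one =>
    change _ = D 1 + _
    rw [hD1, pow_one, trace_transfer]; ring
  | more m h1 h2 =>
    change _ = D (m + 2) + _
    change _ = D m + _ at h1
    rw [trace_transfer_pow_add_two z hz, h1]
    have := hUD m
    simp only [hU, hx, hy] at this
    rw [this]; ring

end Transfer

/-! ### Traces as sums over cyclically reduced words -/

section Words

open Matrix

variable {k : ℕ} {R : Type*} [CommRing R]

/-- The finite set of all words of a given length in the letters and their inverses. -/
def words (k : ℕ) : ℕ → Finset (List (Fin k × Bool))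
  | 0 => {[]}
  | m + 1 => (Finset.univ ×ˢ words k m).image fun p => p.1 :: p.2

theorem mem_words (m : ℕ) (L : List (Fin k × Bool)) : L ∈ words k m ↔ L.length = m := by
  induction m generalizing L with
  | zero => simp [words]
  | succ m ih =>
    cases L with
    | nil => simp [words]
    | cons a L => simp [words, ih]

theorem sum_words_succ (m : ℕ) (f : List (Fin k × Bool) → R) :
    ∑ L ∈ words k (m + 1), f L = ∑ a, ∑ L ∈ words k m, f (a :: L) := by
  rw [words, Finset.sum_image, Finset.sum_product]
  rintro ⟨a, L⟩ _ ⟨b, L'⟩ _ h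
  simpa using h

/-- The weight of a word: the product of the weights of its letters. -/
def wordWeight (z : Fin k × Bool → R) (L : List (Fin k × Bool)) : R := (L.map z).prod

theorem ne_letterInv_iff (a b : Fin k × Bool) : b ≠ letterInv a ↔ (a.1 = b.1 → a.2 = b.2) := by
  obtain ⟨a, s⟩ := a
  obtain ⟨b, t⟩ := b
  simp only [letterInv, ne_eq, Prod.mk.injEq, not_and]
  cases s <;> cases t <;> simp [eq_comm]

open Classical in
-- The final letter `b` carries no weight, so on the diagonal, where `b = a`, each letter of the
-- cyclic word is weighted once.
theorem transfer_pow_apply (z : Fin k × Bool → R) (m : ℕ) (a b : Fin k × Bool) :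
    (transfer z ^ (m + 1)) a b = ∑ L ∈ words k m,
      if FreeGroup.IsReduced (a :: L ++ [b]) then wordWeight z (a :: L) else 0 := by
  induction m generalizing a with
  | zero =>
    simp only [words, zero_add, pow_one, Finset.sum_singleton, transfer, List.cons_append,
      List.nil_append, FreeGroup.isReduced_cons_cons, FreeGroup.IsReduced.singleton, and_true,
      ← ne_letterInv_iff, wordWeight]
    split_ifs <;> simp_all
  | succ m ih =>
    rw [pow_succ', mul_apply, sum_words_succ]
    refine Finset.sum_congr rfl fun c _ => ?_
    rw [ih, Finset.mul_sum]
    refine Finset.sum_congr rfl fun L _ => ?_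
    simp only [transfer, List.cons_append, FreeGroup.isReduced_cons_cons, ← ne_letterInv_iff,
      wordWeight, List.map_cons, List.prod_cons]
    split_ifs <;> simp_all

/-- Repeating the first letter at the end turns the cyclic condition into one more adjacency
condition. -/
theorem isCyclicallyReduced_cons_iff (a : Fin k × Bool) (L : List (Fin k × Bool)) :
    FreeGroup.IsCyclicallyReduced (a :: L) ↔ FreeGroup.IsReduced (a :: L ++ [a]) := by
  rw [FreeGroup.IsCyclicallyReduced, FreeGroup.IsReduced, FreeGroup.IsReduced,
    List.isChain_append]
  simp

open Classical in
theorem trace_transfer_pow_eq_sum_words (z : Fin k × Bool → R) (m : ℕ) :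
    (transfer z ^ (m + 1)).trace = ∑ L ∈ words k (m + 1),
      if FreeGroup.IsCyclicallyReduced L then wordWeight z L else 0 := by
  rw [sum_words_succ, trace]
  refine Finset.sum_congr rfl fun a _ => ?_
  simp only [diag_apply, transfer_pow_apply, isCyclicallyReduced_cons_iff]

/-- The exponent vector of a letter. -/
def letterExp (a : Fin k × Bool) : Fin k → ℤ := Pi.single a.1 (if a.2 then 1 else -1)

theorem Phi_mk (L : List (Fin k × Bool)) : Phi (FreeGroup.mk L) = (L.map letterExp).sum := by
  induction L with
  | nil => ext j; simp [Phi, discreteLog, FreeGroup.lift_mk]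
  | cons a L ih =>
    rw [List.map_cons, List.sum_cons, ← ih]
    ext j
    obtain ⟨i, b⟩ := a
    simp only [Phi, discreteLog, FreeGroup.lift_mk, letterExp, List.map_cons, List.prod_cons,
      Pi.add_apply, toAdd_mul, Pi.single_apply]
    cases b <;> by_cases h : j = i <;> simp [h, eq_comm (a := i)]

open Classical in
theorem n_eq_sum (β : Fin k → ℤ) (m : ℕ) : n β m = ∑ L ∈ words k m,
    if FreeGroup.IsCyclicallyReduced L then (if (L.map letterExp).sum = β then 1 else 0) else 0 := by
  have : n β m = ((words k m).filter fun L => FreeGroup.IsCyclicallyReduced L ∧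
      (L.map letterExp).sum = β).card := by
    rw [← Set.ncard_coe_finset, n]
    refine Set.ncard_congr (fun γ _ => γ.toWord) ?_ (fun _ _ _ _ h => FreeGroup.toWord_injective h) ?_
    · rintro γ ⟨h1, h2, h3⟩
      simp only [Finset.coe_filter, Set.mem_ofPred_eq, mem_words]
      refine ⟨h2, h1, ?_⟩
      rw [← Phi_mk, FreeGroup.mk_toWord, h3]
    · intro L hL
      simp only [Finset.coe_filter, Set.mem_ofPred_eq, mem_words] at hL
      have h : (FreeGroup.mk L).toWord = L := by
        rw [FreeGroup.toWord_mk, hL.2.1.isReduced.reduce_eq]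
      refine ⟨FreeGroup.mk L, ⟨?_, ?_, ?_⟩, h⟩
      · change FreeGroup.IsCyclicallyReduced _
        rw [h]; exact hL.2.1
      · rw [FreeGroup.norm, h, hL.1]
      · rw [Phi_mk, hL.2.2]
  rw [this, Finset.card_filter]
  exact Finset.sum_congr rfl fun L _ => ite_and _ _ _ _

end Words

end FreeGroupCount

/-! ### Fourier inversion on the torus -/

namespace FreeGroupCount

open MeasureTheory UnitAddTorus

variable {k : ℕ}

/-- Normalised Haar measure on the torus. -/
noncomputable def torusMeasure (k : ℕ) : Measure (UnitAddTorus (Fin k)) :=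
  Measure.pi fun _ => AddCircle.haarAddCircle

instance : IsProbabilityMeasure (torusMeasure k) := by
  unfold torusMeasure; infer_instance

instance : (torusMeasure k).IsAddHaarMeasure := by
  unfold torusMeasure; infer_instance

theorem integral_torus_eq (f : UnitAddTorus (Fin k) → ℂ) (a : Fin k → ℝ) :
    ∫ x, f x ∂torusMeasure k =
      ∫ x : Fin k → ℝ in {x | ∀ i, x i ∈ Set.Ioc (a i) (a i + 1)}, f (fun i => x i) :=
  UnitAddTorus.integral_preimage f a

theorem integral_mFourier (β : Fin k → ℤ) :
    ∫ x, mFourier β x ∂torusMeasure k = if β = 0 then 1 else 0 := by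
  split_ifs with h
  · simp [h, mFourier_zero]
  · obtain ⟨i, hi⟩ := Function.ne_iff.mp h
    unfold torusMeasure
    simp only [mFourier, ContinuousMap.coe_mk]
    rw [MeasureTheory.integral_fintype_prod_eq_prod (𝕜 := ℂ) (fun i (x : UnitAddCircle) => fourier (β i) x)]
    apply Finset.prod_eq_zero (Finset.mem_univ i)
    have := (orthonormal_iff_ite.mp (orthonormal_fourier (T := 1))) 0 (β i)
    rw [ContinuousMap.inner_toLp] at this
    rw [if_neg (show (0 : ℤ) ≠ β i from Ne.symm hi)] at this
    simpa using this

theorem integrable_torus {f : UnitAddTorus (Fin k) → ℂ} (hf : Continuous f) :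
    Integrable f (torusMeasure k) := by
  simpa using hf.continuousOn.integrableOn_compact (μ := torusMeasure k) isCompact_univ

/-- The unitary weight of letters attached to a point of the torus. -/
noncomputable def letterChar (x : UnitAddTorus (Fin k)) (a : Fin k × Bool) : ℂ :=
  mFourier (letterExp a) x

theorem letterExp_letterInv (a : Fin k × Bool) : letterExp (letterInv a) = -letterExp a := by
  obtain ⟨i, b⟩ := a
  cases b <;> simp [letterExp, letterInv, ← Pi.single_neg]

theorem letterChar_mul_letterInv (x : UnitAddTorus (Fin k)) (a : Fin k × Bool) :
    letterChar x a * letterChar x (letterInv a) = 1 := by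
  rw [letterChar, letterChar, ← mFourier_add, letterExp_letterInv, add_neg_cancel, mFourier_zero]
  rfl

theorem wordWeight_letterChar (x : UnitAddTorus (Fin k)) (L : List (Fin k × Bool)) :
    wordWeight (letterChar x) L = mFourier (L.map letterExp).sum x := by
  induction L with
  | nil => simp [wordWeight, mFourier_zero]
  | cons a L ih =>
    rw [wordWeight] at ih
    rw [wordWeight, List.map_cons, List.prod_cons, ih, List.map_cons, List.sum_cons, mFourier_add]
    rfl

/-- The sum of the cosines of the coordinates of a point of the torus. -/
noncomputable def cosSum (x : UnitAddTorus (Fin k)) : ℝ := ∑ j, (fourier 1 (x j) : ℂ).re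

theorem continuous_cosSum : Continuous (cosSum (k := k)) := by
  unfold cosSum; fun_prop

theorem sum_letterChar (x : UnitAddTorus (Fin k)) :
    ∑ a, letterChar x a = ((2 * cosSum x : ℝ) : ℂ) := by
  rw [Fintype.sum_prod_type, cosSum, Finset.mul_sum, Complex.ofReal_sum]
  refine Finset.sum_congr rfl fun j _ => ?_
  have : letterExp (j, false) = -letterExp (j, true) := letterExp_letterInv (j, true)
  rw [Fintype.sum_bool, letterChar, letterChar, this, mFourier_neg, Complex.add_conj, letterExp]
  simp only [if_true, mFourier_single]

/-- The part of the character sum of cyclically reduced words of length `m` that carries the main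
term. -/
noncomputable def mainChar (m : ℕ) (t : ℝ) : ℝ := (Polynomial.dickson 1 (q k) m).eval (2 * t)

theorem continuous_mainChar (m : ℕ) : Continuous (mainChar (k := k) m) := by
  unfold mainChar; fun_prop

theorem mainChar_neg (m : ℕ) (t : ℝ) :
    mainChar (k := k) m (-t) = (-1) ^ m * mainChar (k := k) m t := by
  rw [mainChar, mul_neg, dickson_eval_neg, mainChar]

theorem trace_letterChar (x : UnitAddTorus (Fin k)) (m : ℕ) :
    (transfer (letterChar x) ^ m).trace
      = (mainChar (k := k) m (cosSum x) : ℂ) + (k - 1) * (1 + (-1) ^ m) := by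
  rw [trace_transfer_pow _ (letterChar_mul_letterInv x), sum_letterChar]
  have := dickson_eval_map Complex.ofRealHom (q k) (2 * cosSum x) m
  simp only [Complex.ofRealHom_eq_coe] at this
  rw [mainChar, ← this]
  simp [q]

/-- The counting function as a Fourier coefficient. -/
theorem n_eq_integral_add (β : Fin k → ℤ) (m : ℕ) (hm : m ≠ 0) :
    (n β m : ℂ) = (∫ x, (mainChar (k := k) m (cosSum x) : ℂ) * mFourier (-β) x ∂torusMeasure k)
      + (k - 1) * (1 + (-1) ^ m) * if β = 0 then 1 else 0 := by
  classical
  have h1 : (n β m : ℂ)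
      = ∫ x, (transfer (letterChar x) ^ m).trace * mFourier (-β) x ∂torusMeasure k := by
    -- Length zero is excluded: the trace of the identity is `2k`, but there is only one empty word.
    obtain ⟨m, rfl⟩ := Nat.exists_eq_succ_of_ne_zero hm
    simp only [Nat.succ_eq_add_one, trace_transfer_pow_eq_sum_words, Finset.sum_mul, ite_mul,
      zero_mul, wordWeight_letterChar, ← mFourier_add]
    rw [integral_finsetSum, n_eq_sum, Nat.cast_sum]
    · refine Finset.sum_congr rfl fun L _ => ?_
      split_ifs with h h'
      · rw [integral_mFourier, if_pos (by rw [h', add_neg_cancel]), Nat.cast_one]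
      · rw [integral_mFourier, if_neg (by rwa [← sub_eq_add_neg, sub_eq_zero]), Nat.cast_zero]
      · simp
    · intro L _
      split_ifs
      · exact integrable_torus (by fun_prop)
      · simp
  have hc := (continuous_mainChar (k := k) m).comp (continuous_cosSum (k := k))
  rw [h1]
  simp only [trace_letterChar, add_mul _ _ (mFourier _ _)]
  rw [integral_add, integral_const_mul, integral_mFourier]
  · simp only [neg_eq_zero]
  · exact integrable_torus ((Complex.continuous_ofReal.comp hc).mul (by fun_prop))
  · exact integrable_torus (by fun_prop)

/-! ### The half-point symmetry and the parity factor -/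

/-- The indicator of the positive reals, normalised at `0`. -/
noncomputable def posWeight (t : ℝ) : ℝ := (1 + Real.sign t) / 2

/-- The value `1/2` at `0` makes this hold everywhere, so the zero set of `cosSum` needs no separate
treatment. -/
theorem posWeight_add_neg (t : ℝ) : posWeight t + posWeight (-t) = 1 := by
  rw [posWeight, posWeight, Real.sign_neg]; ring

theorem posWeight_of_pos {t : ℝ} (ht : 0 < t) : posWeight t = 1 := by
  rw [posWeight, Real.sign_of_pos ht]; norm_num

theorem posWeight_of_neg {t : ℝ} (ht : t < 0) : posWeight t = 0 := by
  rw [posWeight, Real.sign_of_neg ht]; norm_num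

theorem abs_posWeight_le (t : ℝ) : |posWeight t| ≤ 1 := by
  rcases Real.sign_apply_eq t with h | h | h <;> rw [posWeight, h] <;> norm_num

theorem measurable_posWeight : Measurable posWeight := by
  unfold posWeight Real.sign
  refine Measurable.div_const (measurable_const.add ?_) _
  exact Measurable.ite measurableSet_Iio measurable_const
    (Measurable.ite measurableSet_Ioi measurable_const measurable_const)

/-- The point of order two of the torus with all coordinates nonzero. -/
noncomputable def halfPoint (k : ℕ) : UnitAddTorus (Fin k) := fun _ => ((1 / 2 : ℝ) : UnitAddCircle)

theorem fourier_add_half (b : ℤ) (y : UnitAddCircle) :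
    (fourier b (y + ((1 / 2 : ℝ) : UnitAddCircle)) : ℂ) = (-1) ^ b * fourier b y := by
  rw [fourier_apply, smul_add, AddCircle.toCircle_add, Circle.coe_mul, ← fourier_apply,
    ← fourier_apply, mul_comm, fourier_coe_apply]
  congr 1
  rw [← Complex.exp_pi_mul_I, ← Complex.exp_int_mul]
  congr 1
  push_cast
  ring

theorem mFourier_add_halfPoint (β : Fin k → ℤ) (x : UnitAddTorus (Fin k)) :
    mFourier β (x + halfPoint k) = (-1) ^ (∑ j, β j) * mFourier β x := by
  simp only [mFourier, ContinuousMap.coe_mk, Pi.add_apply, halfPoint, fourier_add_half,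
    Finset.prod_mul_distrib]
  congr 1
  induction (Finset.univ : Finset (Fin k)) using Finset.induction_on with
  | empty => simp
  | insert a s ha ih =>
    rw [Finset.prod_insert ha, Finset.sum_insert ha, ih, zpow_add₀ (by norm_num)]

theorem cosSum_add_halfPoint (x : UnitAddTorus (Fin k)) :
    cosSum (x + halfPoint k) = -cosSum x := by
  simp only [cosSum, halfPoint, Pi.add_apply, fourier_add_half, ← Finset.sum_neg_distrib]
  simp

/-- Translation by `halfPoint` negates `cosSum` and multiplies the integrand by `(-1)^(m + ∑ j, β
j)`. It carries the negative half of the integral onto the positive half, leaving a single peak. -/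
theorem integral_mainChar (β : Fin k → ℤ) (m : ℕ) :
    ∫ x, (mainChar (k := k) m (cosSum x) : ℂ) * mFourier (-β) x ∂torusMeasure k
      = s m β * ∫ x, ((posWeight (cosSum x) * mainChar (k := k) m (cosSum x) : ℝ) : ℂ)
          * mFourier (-β) x ∂torusMeasure k := by
  have hc := (continuous_mainChar (k := k) m).comp (continuous_cosSum (k := k))
  have hw : Measurable fun x : UnitAddTorus (Fin k) => posWeight (cosSum x) :=
    measurable_posWeight.comp continuous_cosSum.measurable
  set F : UnitAddTorus (Fin k) → ℂ := fun x => (mainChar (k := k) m (cosSum x) : ℂ)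
    * mFourier (-β) x with hF
  have hFi : Integrable F (torusMeasure k) :=
    integrable_torus ((Complex.continuous_ofReal.comp hc).mul (by fun_prop))
  set G : UnitAddTorus (Fin k) → ℂ := fun x => (posWeight (cosSum x) : ℂ) * F x with hG
  have hGi : Integrable G (torusMeasure k) := by
    refine hFi.bdd_mul (c := 1) (Complex.measurable_ofReal.comp hw).aestronglyMeasurable
      (Filter.Eventually.of_forall fun x => ?_)
    simpa using abs_posWeight_le (cosSum x)
  have hsign : ∀ x, (posWeight (-cosSum x) : ℂ) * F x
      = (-1) ^ ((m : ℤ) + ∑ j, β j) * G (x + halfPoint k) := by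
    intro x
    simp only [hG, hF, cosSum_add_halfPoint, mFourier_add_halfPoint, mainChar_neg]
    have e1 : ((-1 : ℂ) ^ ((m : ℤ) + ∑ j, β j)) * ((-1) ^ m * (-1) ^ (∑ j, (-β) j)) = 1 := by
      rw [zpow_add₀ (by norm_num), zpow_natCast]
      simp only [Pi.neg_apply, Finset.sum_neg_distrib, zpow_neg]
      rw [mul_mul_mul_comm, ← mul_pow, mul_inv_cancel₀ (zpow_ne_zero _ (by norm_num))]
      simp
    push_cast
    linear_combination (-(posWeight (-cosSum x) : ℂ) * (mainChar (k := k) m (cosSum x) : ℂ)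
      * mFourier (-β) x) * e1
  have hsplit : ∀ x, F x = G x + (-1) ^ ((m : ℤ) + ∑ j, β j) * G (x + halfPoint k) := by
    intro x
    rw [← hsign, hG]
    simp only
    rw [← add_mul, ← Complex.ofReal_add, posWeight_add_neg, Complex.ofReal_one, one_mul]
  have hGi' : Integrable (fun x => G (x + halfPoint k)) (torusMeasure k) :=
    hGi.comp_add_right _
  calc ∫ x, F x ∂torusMeasure k
      = ∫ x, (G x + (-1) ^ ((m : ℤ) + ∑ j, β j) * G (x + halfPoint k)) ∂torusMeasure k := by
        simp only [← hsplit]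
    _ = s m β * ∫ x, G x ∂torusMeasure k := by
        rw [integral_add hGi (hGi'.const_mul _), integral_const_mul,
          integral_add_right_eq_self (μ := torusMeasure k) G, s]
        push_cast
        ring
    _ = _ := by
        simp only [hG, hF, Complex.ofReal_mul, mul_assoc]

/-! ### Passage to a cube centred at the peak -/

/-- The cube of side one centred at the origin. -/
def unitCube (k : ℕ) : Set (Fin k → ℝ) := {x | ∀ i, x i ∈ Set.Ioc (-1 / 2 : ℝ) (1 / 2)}

theorem measurableSet_unitCube : MeasurableSet (unitCube k) := by
  have : unitCube k = Set.univ.pi fun _ => Set.Ioc (-1 / 2 : ℝ) (1 / 2) := by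
    ext; simp [unitCube]
  rw [this]
  exact MeasurableSet.univ_pi fun _ => measurableSet_Ioc

/-- The sum of the cosines of the coordinates, in turns. -/
noncomputable def realCosSum (x : Fin k → ℝ) : ℝ := ∑ j, Real.cos (2 * Real.pi * x j)

theorem cosSum_coe (x : Fin k → ℝ) :
    cosSum (fun i => (x i : UnitAddCircle)) = realCosSum x := by
  refine Finset.sum_congr rfl fun j _ => ?_
  rw [fourier_coe_apply]
  have : 2 * (Real.pi : ℂ) * Complex.I * (1 : ℤ) * (x j) / (1 : ℝ)
      = ((2 * Real.pi * x j : ℝ) : ℂ) * Complex.I := by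
    push_cast; ring
  rw [this, Complex.exp_ofReal_mul_I_re]

theorem mFourier_coe (β : Fin k → ℤ) (x : Fin k → ℝ) :
    mFourier β (fun i => (x i : UnitAddCircle))
      = Complex.exp (∑ j, 2 * Real.pi * Complex.I * β j * x j) := by
  simp only [mFourier, ContinuousMap.coe_mk, fourier_coe_apply, Complex.exp_sum]
  simp

/-- The counting function as an integral over the cube. -/
theorem n_eq_setIntegral_add (β : Fin k → ℤ) (m : ℕ) (hm : m ≠ 0) :
    (n β m : ℂ) = s m β * (∫ x in unitCube k,
        ((posWeight (realCosSum x) * mainChar (k := k) m (realCosSum x) : ℝ) : ℂ)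
          * Complex.exp (∑ j, -(2 * Real.pi * Complex.I * β j) * x j))
      + (k - 1) * (1 + (-1) ^ m) * if β = 0 then 1 else 0 := by
  rw [n_eq_integral_add β m hm, integral_mainChar, integral_torus_eq _ fun _ => -1 / 2]
  simp only [cosSum_coe, mFourier_coe]
  norm_num [unitCube]

end FreeGroupCount

/-! ### Size and local behaviour of the main term -/

namespace FreeGroupCount

open Filter Topology

/-- A root of a real quadratic with positive constant term `a` has modulus at most `r` as soon as
`r ^ 2 ≥ a` and the linear coefficient is at most `r + a / r` in absolute value. -/
theorem norm_root_le {a r x : ℝ} (ha : 0 < a) (hr : 0 < r) (har : a ≤ r ^ 2)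
    (hx : |x| ≤ r + a / r) {w : ℂ} (hw : w ^ 2 - x * w + a = 0) : ‖w‖ ≤ r := by
  have hre := congrArg Complex.re hw
  have him := congrArg Complex.im hw
  simp only [sq, Complex.add_re, Complex.sub_re, Complex.mul_re, Complex.ofReal_re,
    Complex.ofReal_im, Complex.zero_re, Complex.add_im, Complex.sub_im, Complex.mul_im,
    Complex.zero_im, zero_mul, sub_zero, add_zero] at hre him
  -- Either `w` is real, or it is one of a conjugate pair with product `a`, and then `‖w‖² = a`.
  have him' : w.im * (2 * w.re - x) = 0 := by linarith
  rcases mul_eq_zero.mp him' with h | h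
  · rw [h] at hre
    have hn : ‖w‖ = |w.re| := by
      rw [Complex.norm_eq_sqrt_sq_add_sq, h]; simp [Real.sqrt_sq_eq_abs]
    rw [hn]
    by_contra! hlt
    have h1 : w.re ^ 2 + a ≤ |x| * |w.re| := by
      rw [← abs_mul]; refine le_trans (le_of_eq ?_) (le_abs_self _); linarith
    have h2 : |x| * |w.re| ≤ (r + a / r) * |w.re| := by gcongr
    have h3 : a / r ≤ r := by rw [div_le_iff₀ hr]; linarith
    have h4 : r * (a / r) = a := by field_simp
    have h5 : w.re ^ 2 = |w.re| ^ 2 := (sq_abs _).symm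
    -- Since `a / r ≤ r < |w.re|`, expanding gives `|w.re|² + a > (r + a / r) |w.re|`, against `h1`
    -- and `h2`.
    have h6 : 0 < (|w.re| - r) * (|w.re| - a / r) := mul_pos (by linarith) (by linarith)
    nlinarith
  · have hn : ‖w‖ ^ 2 = a := by
      rw [← Complex.normSq_eq_norm_sq, Complex.normSq_apply]
      have : x = 2 * w.re := by linarith
      rw [this] at hre
      linarith
    exact abs_le_of_sq_le_sq' (by rw [hn]; exact har) hr.le |>.2

/-- The value is `u ^ m + v ^ m` for the complex roots `u`, `v` of `w² - x w + a`, both bounded by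
`norm_root_le`. -/
theorem abs_dickson_eval_le {a r x : ℝ} (ha : 0 < a) (hr : 0 < r) (har : a ≤ r ^ 2)
    (hx : |x| ≤ r + a / r) (m : ℕ) : |(Polynomial.dickson 1 a m).eval x| ≤ 2 * r ^ m := by
  obtain ⟨d, hd⟩ := IsAlgClosed.exists_pow_nat_eq ((x : ℂ) ^ 2 - 4 * a) (n := 2) (by norm_num)
  set u : ℂ := (x + d) / 2 with hu
  set v : ℂ := (x - d) / 2 with hv
  have hadd : u + v = x := by rw [hu, hv]; ring
  have hmul : u * v = a := by rw [hu, hv]; linear_combination (-1 / 4 : ℂ) * hd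
  have h := dickson_eval_map Complex.ofRealHom a x m
  simp only [Complex.ofRealHom_eq_coe] at h
  rw [← hadd, ← hmul, dickson_eval_add] at h
  have hun : ‖u‖ ≤ r := norm_root_le ha hr har hx (by linear_combination -hmul + u * hadd)
  have hvn : ‖v‖ ≤ r := norm_root_le ha hr har hx (by linear_combination -hmul + v * hadd)
  rw [← Real.norm_eq_abs, ← Complex.norm_real, ← h]
  calc ‖u ^ m + v ^ m‖ ≤ ‖u‖ ^ m + ‖v‖ ^ m := by
        simpa only [norm_pow] using norm_add_le (u ^ m) (v ^ m)
    _ ≤ r ^ m + r ^ m := by gcongr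
    _ = _ := by ring

variable {k : ℕ}

theorem one_lt_q (hk : 2 ≤ k) : 1 < q k := by
  have : (2 : ℝ) ≤ k := by exact_mod_cast hk
  unfold q; linarith

/-- Exponential decay of the main term away from its maximum. -/
theorem exists_abs_mainChar_le (hk : 2 ≤ k) : ∃ c : ℝ, 0 < c ∧ ∀ (m : ℕ) (t : ℝ), |t| ≤ k →
    |mainChar (k := k) m t| ≤ 2 * (q k ^ m * Real.exp (-(c * (m * (k - |t|))))) := by
  have hk' : (2 : ℝ) ≤ k := by exact_mod_cast hk
  have hq := one_lt_q hk
  have hlog := Real.log_pos hq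
  have hk1 : (0 : ℝ) < k - 1 := by linarith
  -- With `r = q e^(-cd)`, the bound `c ≤ log q / (2k)` and `d ≤ k` give `q ≤ r²`. The bound `c ≤
  -- 1/(k - 1)` and `e^x ≥ 1 + x` give `r + q/r ≥ 2k - 2(k - 1)cd ≥ 2|t|`.
  set c : ℝ := min (1 / (k - 1)) (Real.log (q k) / (2 * k)) with hc
  have hc0 : 0 < c := lt_min (by positivity) (by positivity)
  refine ⟨c, hc0, fun m t ht => ?_⟩
  set d : ℝ := k - |t| with hd
  have hd0 : 0 ≤ d := by rw [hd]; linarith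
  have hdk : d ≤ k := by rw [hd]; linarith [abs_nonneg t]
  have hq0 : 0 < q k := by linarith
  set r : ℝ := q k * Real.exp (-(c * d)) with hr
  have hr0 : 0 < r := by positivity
  have h1 : q k ≤ r ^ 2 := by
    have h2 : 1 ≤ q k * Real.exp (-(2 * (c * d))) := by
      rw [← Real.exp_log hq0, ← Real.exp_add, Real.one_le_exp_iff]
      have h3 : c * d ≤ Real.log (q k) / (2 * k) * k :=
        mul_le_mul (min_le_right _ _) hdk hd0 (by positivity)
      have h4 : Real.log (q k) / (2 * k) * k = Real.log (q k) / 2 := by field_simp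
      linarith
    have h5 : r ^ 2 = q k * (q k * Real.exp (-(2 * (c * d)))) := by
      rw [hr, mul_pow, ← Real.exp_nat_mul]; push_cast; ring_nf
    rw [h5]
    nlinarith
  have h2 : |2 * t| ≤ r + q k / r := by
    have h3 : q k / r = Real.exp (c * d) := by
      rw [hr, Real.exp_neg]; field_simp
    have h4 := Real.add_one_le_exp (c * d)
    have h5 := Real.add_one_le_exp (-(c * d))
    have h6 : q k * (-(c * d) + 1) ≤ r := by rw [hr]; gcongr
    have h7 : (k - 1) * c ≤ 1 := by
      have : c ≤ 1 / (k - 1) := min_le_left _ _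
      rwa [le_div_iff₀ hk1, mul_comm] at this
    have h8 : (k - 1) * c * d ≤ d := by nlinarith
    rw [h3, abs_mul, abs_two]
    have h9 : |t| = k - d := by rw [hd]; ring
    rw [h9]
    unfold q at h6
    linarith
  refine (abs_dickson_eval_le hq0 hr0 h1 h2 m).trans (le_of_eq ?_)
  rw [hr, mul_pow, ← Real.exp_nat_mul]
  ring_nf

theorem mainChar_eq_of_le {t : ℝ} (ht : q k ≤ t ^ 2) (m : ℕ) :
    mainChar (k := k) m t = (t + √(t ^ 2 - q k)) ^ m + (t - √(t ^ 2 - q k)) ^ m := by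
  rw [← dickson_eval_add, mainChar]
  have := Real.sq_sqrt (sub_nonneg.mpr ht)
  congr 2
  · ring
  · linear_combination this

/-- Near its maximum the main term behaves like a Gaussian. -/
theorem tendsto_mainChar_div (hk : 2 ≤ k) {t : ℕ → ℝ} {l : ℝ} (ht : Tendsto t atTop (𝓝 k))
    (hl : Tendsto (fun m : ℕ => (m : ℝ) * (t m - k)) atTop (𝓝 l)) :
    Tendsto (fun m => mainChar (k := k) m (t m) / q k ^ m) atTop
      (𝓝 (Real.exp (l * sigmaSq k))) := by
  have hk' : (2 : ℝ) ≤ k := by exact_mod_cast hk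
  have hk1 : (0 : ℝ) < k - 1 := by linarith
  have hq := one_lt_q hk
  have hq0 : 0 < q k := by linarith
  have hsq : (k : ℝ) ^ 2 - q k = (k - 1) ^ 2 := by unfold q; ring
  have hev : ∀ᶠ m in atTop, q k < t m ^ 2 := by
    refine (ht.pow 2).eventually_const_lt ?_
    nlinarith [sq_pos_of_pos hk1]
  have hroot : Tendsto (fun m => √(t m ^ 2 - q k)) atTop (𝓝 (k - 1)) := by
    have := (Real.continuous_sqrt.tendsto _).comp ((ht.pow 2).sub_const (q k))
    rwa [hsq, Real.sqrt_sq hk1.le] at this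
  have hlarge : Tendsto (fun m => (1 + ((t m + √(t m ^ 2 - q k)) / q k - 1)) ^ m) atTop
      (𝓝 (Real.exp (l * sigmaSq k))) := by
    refine Real.tendsto_one_add_pow_exp_of_tendsto ?_
    have h1 : Tendsto (fun m : ℕ => (m : ℝ) * (t m - k)
        * ((1 + (t m + k) / (√(t m ^ 2 - q k) + (k - 1))) / q k)) atTop
        (𝓝 (l * ((1 + (k + k) / ((k - 1) + (k - 1))) / q k))) :=
      hl.mul ((((ht.add_const _).div (hroot.add_const _) (by positivity)).const_add 1).div_const _)
    have h2 : (1 + ((k : ℝ) + k) / ((k - 1) + (k - 1))) / q k = sigmaSq k := by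
      have h3 : 1 + ((k : ℝ) + k) / ((k - 1) + (k - 1)) = q k * ((k : ℝ) - 1)⁻¹ := by
        unfold q; field_simp; ring
      rw [h3, mul_div_cancel_left₀ _ hq0.ne', sigmaSq]
    rw [h2] at h1
    refine h1.congr' ?_
    filter_upwards [hev] with m hm
    have h3 := Real.sq_sqrt (sub_nonneg.mpr hm.le)
    have h4 : 0 < √(t m ^ 2 - q k) + (k - 1) := by positivity
    -- Rationalise `√(t² - q) - (k - 1)`, using `q + (k - 1)² = k²`.
    have h5 : (t m - k) * (1 + (t m + k) / (√(t m ^ 2 - q k) + (k - 1)))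
        = t m + √(t m ^ 2 - q k) - q k := by
      field_simp
      unfold q at h3 ⊢
      linear_combination -h3
    rw [mul_assoc, ← mul_div_assoc, h5]
    field_simp
  -- The smaller root tends to `1`, so its ratio to `q` stays below a constant less than `1`.
  have hsmall : Tendsto (fun m => ((t m - √(t m ^ 2 - q k)) / q k) ^ m) atTop (𝓝 0) := by
    have h1 : Tendsto (fun m => |(t m - √(t m ^ 2 - q k)) / q k|) atTop
        (𝓝 |((k : ℝ) - (k - 1)) / q k|) := ((ht.sub hroot).div_const _).abs
    have h2 : |((k : ℝ) - (k - 1)) / q k| < 1 := by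
      rw [abs_of_pos (by rw [sub_sub_cancel]; positivity), div_lt_one hq0]; linarith
    obtain ⟨ρ, hρ1, hρ2⟩ := exists_between h2
    refine squeeze_zero_norm' ?_ (tendsto_pow_atTop_nhds_zero_of_lt_one
      ((abs_nonneg _).trans hρ1.le) hρ2)
    filter_upwards [h1.eventually_lt_const hρ1] with m hm
    rw [norm_pow, Real.norm_eq_abs]
    gcongr
  have := hlarge.add hsmall
  rw [add_zero] at this
  refine this.congr' ?_
  filter_upwards [hev] with m hm
  rw [mainChar_eq_of_le hm.le, add_div _ _ (q k ^ m), ← div_pow, ← div_pow, add_sub_cancel]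

theorem tendsto_mul_cos_sub_one (a : ℝ) :
    Tendsto (fun m : ℕ => (m : ℝ) * (Real.cos ((√(m : ℝ))⁻¹ * a) - 1)) atTop
      (𝓝 (-(a ^ 2 / 2))) := by
  have hs : Tendsto (fun m : ℕ => (√(m : ℝ))⁻¹ * a) atTop (𝓝 0) := by
    have h := (Real.tendsto_sqrt_atTop.comp
      tendsto_natCast_atTop_atTop).inv_tendsto_atTop.mul_const a
    simpa using h
  have hu : ∀ᶠ m : ℕ in atTop, |(√(m : ℝ))⁻¹ * a| ≤ 1 := by
    have := hs.abs
    rw [abs_zero] at this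
    filter_upwards [this.eventually_lt_const one_pos] with m hm using hm.le
  rw [tendsto_iff_norm_sub_tendsto_zero]
  -- The fourth-order error `(5/96) u⁴` of `Real.cos_bound`, multiplied by `m`, is `(5/96) a² u²`
  -- because `m u² = a²`.
  refine squeeze_zero' (g := fun m : ℕ => ((√(m : ℝ))⁻¹ * a) ^ 2 * (a ^ 2 * (5 / 96)))
    (Eventually.of_forall fun _ => norm_nonneg _) ?_ ?_
  · filter_upwards [hu, eventually_gt_atTop 0] with m hm hm0
    have hm0' : (0 : ℝ) < m := by exact_mod_cast hm0
    have hb := Real.cos_bound hm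
    set u := (√(m : ℝ))⁻¹ * a with hu'
    have hmu : (m : ℝ) * u ^ 2 = a ^ 2 := by
      rw [hu', mul_pow, inv_pow, Real.sq_sqrt hm0'.le]; field_simp
    have e1 : (m : ℝ) * (Real.cos u - 1) - -(a ^ 2 / 2) = m * (Real.cos u - (1 - u ^ 2 / 2)) := by
      rw [← hmu]; ring
    rw [e1, norm_mul, Real.norm_eq_abs, Real.norm_eq_abs, abs_of_pos hm0']
    calc (m : ℝ) * |Real.cos u - (1 - u ^ 2 / 2)| ≤ m * (|u| ^ 4 * (5 / 96)) := by gcongr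
      _ = u ^ 2 * ((m * u ^ 2) * (5 / 96)) := by
        rw [show |u| ^ 4 = (|u| ^ 2) ^ 2 by ring, sq_abs]; ring
      _ = _ := by rw [hmu]
  · have := (hs.pow 2).mul_const (a ^ 2 * (5 / 96))
    simpa using this

theorem tendsto_mul_realCosSum_sub (y : Fin k → ℝ) :
    Tendsto (fun m : ℕ => (m : ℝ) * (realCosSum ((√(m : ℝ))⁻¹ • y) - k)) atTop
      (𝓝 (-(2 * Real.pi ^ 2 * ∑ j, y j ^ 2))) := by
  have h := tendsto_finsetSum (Finset.univ : Finset (Fin k)) fun j _ =>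
    tendsto_mul_cos_sub_one (2 * Real.pi * y j)
  have e : ∑ j, -((2 * Real.pi * y j) ^ 2 / 2) = -(2 * Real.pi ^ 2 * ∑ j, y j ^ 2) := by
    rw [Finset.mul_sum, ← Finset.sum_neg_distrib]
    exact Finset.sum_congr rfl fun j _ => by ring
  rw [e] at h
  refine h.congr fun m => ?_
  rw [← Finset.mul_sum, Finset.sum_sub_distrib, realCosSum]
  simp only [Pi.smul_apply, smul_eq_mul, Finset.sum_const, Finset.card_univ, Fintype.card_fin,
    nsmul_eq_mul, mul_one]
  congr 3
  ext j
  ring_nf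

theorem tendsto_realCosSum (y : Fin k → ℝ) :
    Tendsto (fun m : ℕ => realCosSum ((√(m : ℝ))⁻¹ • y)) atTop (𝓝 k) := by
  have h := (tendsto_mul_realCosSum_sub y).mul tendsto_inv_atTop_nhds_zero_nat
  rw [mul_zero] at h
  rw [← tendsto_sub_nhds_zero_iff]
  refine h.congr' ?_
  filter_upwards [eventually_gt_atTop 0] with m hm
  have : (m : ℝ) ≠ 0 := by positivity
  field_simp

theorem abs_realCosSum_le (x : Fin k → ℝ) : |realCosSum x| ≤ k := by
  refine (Finset.abs_sum_le_sum_abs _ _).trans ?_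
  refine (Finset.sum_le_sum fun j _ => Real.abs_cos_le_one _).trans ?_
  simp

theorem realCosSum_le {x : Fin k → ℝ} (hx : x ∈ unitCube k) :
    realCosSum x ≤ k - 8 * ∑ j, x j ^ 2 := by
  have : ∀ j ∈ Finset.univ, Real.cos (2 * Real.pi * x j) ≤ 1 - 8 * x j ^ 2 := by
    intro j _
    have h := hx j
    have hpi := Real.pi_pos
    refine (Real.cos_le_one_sub_mul_cos_sq ?_).trans (le_of_eq ?_)
    · rw [abs_mul, abs_of_pos (by positivity)]
      have : |x j| ≤ 1 / 2 := abs_le.mpr ⟨by linarith [h.1], h.2⟩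
      nlinarith
    · field_simp; ring
  refine (Finset.sum_le_sum this).trans (le_of_eq ?_)
  rw [Finset.sum_sub_distrib, ← Finset.mul_sum]
  simp

theorem zero_mem_unitCube_nhds : unitCube k ∈ 𝓝 (0 : Fin k → ℝ) := by
  have : unitCube k = Set.univ.pi fun _ => Set.Ioc (-1 / 2 : ℝ) (1 / 2) := by
    ext; simp [unitCube]
  rw [this]
  refine set_pi_mem_nhds Set.finite_univ fun i _ => ?_
  exact Ioc_mem_nhds (by norm_num) (by norm_num)

end FreeGroupCount

/-! ### Dominated convergence and the local limit theorem -/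

namespace FreeGroupCount

open Filter Topology MeasureTheory

variable {k : ℕ}

/-- The normalised and rescaled integrand, extended by zero outside the cube. -/
noncomputable def rescaled (k m : ℕ) (y : Fin k → ℝ) : ℝ :=
  (unitCube k).indicator
    (fun x => posWeight (realCosSum x) * mainChar (k := k) m (realCosSum x) / q k ^ m)
    ((√(m : ℝ))⁻¹ • y)

/-- The Gaussian limit of the rescaled integrands. -/
noncomputable def limitGaussian (k : ℕ) (y : Fin k → ℝ) : ℝ :=
  Real.exp (-(2 * Real.pi ^ 2 * sigmaSq k) * ∑ j, y j ^ 2)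

theorem sigmaSq_pos (hk : 2 ≤ k) : 0 < sigmaSq k := by
  have hk' : (2 : ℝ) ≤ k := by exact_mod_cast hk
  exact inv_pos.mpr (by linarith)

theorem continuous_realCosSum : Continuous (realCosSum (k := k)) := by
  unfold realCosSum; fun_prop

theorem measurable_rescaled (m : ℕ) : Measurable (rescaled k m) := by
  have h1 : Measurable fun x : Fin k → ℝ =>
      posWeight (realCosSum x) * mainChar (k := k) m (realCosSum x) / q k ^ m :=
    ((measurable_posWeight.comp continuous_realCosSum.measurable).mul
      ((continuous_mainChar m).comp continuous_realCosSum).measurable).div_const _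
  exact (h1.indicator measurableSet_unitCube).comp (measurable_const_smul _)

theorem integrable_exp_neg_mul_sum_sq {b : ℝ} (hb : 0 < b) :
    Integrable fun y : Fin k → ℝ => Real.exp (-b * ∑ j, y j ^ 2) := by
  have : (fun y : Fin k → ℝ => Real.exp (-b * ∑ j, y j ^ 2))
      = fun y => ∏ j, Real.exp (-b * y j ^ 2) := by
    ext y; rw [Finset.mul_sum, Real.exp_sum]
  rw [this]
  exact Integrable.fintype_prod fun _ => integrable_exp_neg_mul_sq hb

theorem integrable_limitGaussian (hk : 2 ≤ k) : Integrable (limitGaussian k) :=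
  integrable_exp_neg_mul_sum_sq (by have := sigmaSq_pos hk; positivity)

theorem tendsto_rescaled (hk : 2 ≤ k) (y : Fin k → ℝ) :
    Tendsto (fun m => rescaled k m y) atTop (𝓝 (limitGaussian k y)) := by
  have h := tendsto_mainChar_div hk (tendsto_realCosSum y) (tendsto_mul_realCosSum_sub y)
  have e : -(2 * Real.pi ^ 2 * ∑ j, y j ^ 2) * sigmaSq k
      = -(2 * Real.pi ^ 2 * sigmaSq k) * ∑ j, y j ^ 2 := by ring
  rw [e] at h
  refine h.congr' ?_
  have hs : Tendsto (fun m : ℕ => (√(m : ℝ))⁻¹ • y) atTop (𝓝 0) := by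
    have h := (Real.tendsto_sqrt_atTop.comp
      tendsto_natCast_atTop_atTop).inv_tendsto_atTop.smul_const y
    simpa using h
  have hk0 : (0 : ℝ) < k := by exact_mod_cast (by omega : 0 < k)
  filter_upwards [hs.eventually_mem zero_mem_unitCube_nhds,
    (tendsto_realCosSum y).eventually_const_lt hk0] with m hm hm'
  rw [rescaled, Set.indicator_of_mem hm, posWeight_of_pos hm', one_mul]

/-- `posWeight` removes the peak at `-k`. Where `t ≥ 0`, the bound `cos (2πx) ≤ 1 - 8x²` on the cube
turns decay in `m (k - t)` into Gaussian decay in `y`. -/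
theorem exists_abs_rescaled_le (hk : 2 ≤ k) : ∃ c : ℝ, 0 < c ∧ ∀ m : ℕ, m ≠ 0 →
    ∀ y : Fin k → ℝ, |rescaled k m y| ≤ 2 * Real.exp (-c * ∑ j, y j ^ 2) := by
  obtain ⟨c, hc, hbound⟩ := exists_abs_mainChar_le hk
  refine ⟨8 * c, by positivity, fun m hm y => ?_⟩
  have hm' : (0 : ℝ) < m := by exact_mod_cast Nat.pos_of_ne_zero hm
  have hq0 : 0 < q k := by linarith [one_lt_q hk]
  by_cases hy : (√(m : ℝ))⁻¹ • y ∈ unitCube k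
  swap
  · rw [rescaled, Set.indicator_of_notMem hy, abs_zero]; positivity
  rw [rescaled, Set.indicator_of_mem hy]
  have hle := realCosSum_le hy
  have habs := abs_realCosSum_le ((√(m : ℝ))⁻¹ • y)
  set t := realCosSum ((√(m : ℝ))⁻¹ • y) with ht
  rcases lt_or_ge t 0 with h0 | h0
  · rw [posWeight_of_neg h0, zero_mul, zero_div, abs_zero]; positivity
  have hsum : (m : ℝ) * ∑ j, ((√(m : ℝ))⁻¹ • y) j ^ 2 = ∑ j, y j ^ 2 := by
    simp only [Pi.smul_apply, smul_eq_mul, mul_pow, inv_pow, Real.sq_sqrt hm'.le, ← Finset.mul_sum]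
    field_simp
  rw [abs_div, abs_mul, abs_of_pos (pow_pos hq0 m), div_le_iff₀ (pow_pos hq0 m)]
  calc |posWeight t| * |mainChar (k := k) m t|
      ≤ 1 * (2 * (q k ^ m * Real.exp (-(c * (m * (k - |t|)))))) :=
        mul_le_mul (abs_posWeight_le t) (hbound m t habs) (abs_nonneg _) zero_le_one
    _ ≤ 1 * (2 * (q k ^ m * Real.exp (-(8 * c) * ∑ j, y j ^ 2))) := by
        gcongr
        rw [abs_of_nonneg h0, ← hsum]
        have : c * (m * (8 * ∑ j, ((√(m : ℝ))⁻¹ • y) j ^ 2)) ≤ c * (m * (k - t)) := by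
          gcongr; linarith
        linarith
    _ = _ := by ring

/-- The `L¹` distance between the rescaled integrand and its Gaussian limit. -/
noncomputable def gaussianError (k m : ℕ) : ℝ :=
  ∫ y : Fin k → ℝ, |rescaled k m y - limitGaussian k y|

theorem integrable_rescaled (hk : 2 ≤ k) {m : ℕ} (hm : m ≠ 0) : Integrable (rescaled k m) := by
  obtain ⟨c, hc, hbound⟩ := exists_abs_rescaled_le hk
  exact ((integrable_exp_neg_mul_sum_sq hc).const_mul 2).mono'
    (measurable_rescaled m).aestronglyMeasurable (Eventually.of_forall (hbound m hm))

/-- Convergence in `L¹` is what gives uniformity in `β`: the characters have modulus one, so this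
one quantity bounds the error of every Fourier coefficient. -/
theorem tendsto_gaussianError (hk : 2 ≤ k) : Tendsto (gaussianError k) atTop (𝓝 0) := by
  obtain ⟨c, hc, hbound⟩ := exists_abs_rescaled_le hk
  have h : Tendsto (gaussianError k) atTop (𝓝 (∫ _ : Fin k → ℝ, (0 : ℝ))) := by
    refine tendsto_integral_filter_of_dominated_convergence
      (fun y => 2 * Real.exp (-c * ∑ j, y j ^ 2) + limitGaussian k y) ?_ ?_ ?_ ?_
    · filter_upwards [eventually_ne_atTop 0] with m hm
      exact ((integrable_rescaled hk hm).sub (integrable_limitGaussian hk)).abs.aestronglyMeasurable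
    · filter_upwards [eventually_ne_atTop 0] with m hm
      refine Eventually.of_forall fun y => ?_
      rw [Real.norm_eq_abs, abs_abs]
      refine (abs_sub _ _).trans (add_le_add (hbound m hm y) (le_of_eq ?_))
      exact abs_of_pos (Real.exp_pos _)
    · exact ((integrable_exp_neg_mul_sum_sq hc).const_mul 2).add (integrable_limitGaussian hk)
    · refine Eventually.of_forall fun y => ?_
      have := ((tendsto_rescaled hk y).sub_const (limitGaussian k y)).abs
      rwa [sub_self, abs_zero] at this
  simpa using h

/-- The Fourier transform of the limiting Gaussian. -/
theorem gaussian_eq_integral (hk : 2 ≤ k) {m : ℕ} (hm : m ≠ 0) (β : Fin k → ℤ) :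
    (gaussian m β : ℂ) = ∫ y : Fin k → ℝ, (limitGaussian k y : ℂ)
      * Complex.exp (∑ j, -(2 * Real.pi * Complex.I * β j) * ((√(m : ℝ))⁻¹ * y j : ℝ)) := by
  have hσ := sigmaSq_pos hk
  have hm' : (0 : ℝ) < m := by exact_mod_cast Nat.pos_of_ne_zero hm
  set b : ℝ := 2 * Real.pi ^ 2 * sigmaSq k with hb
  have hb0 : 0 < b := by positivity
  have h := GaussianFourier.integral_cexp_neg_mul_sum_add (b := (b : ℂ)) (by simpa using hb0)
    (fun j : Fin k => -(2 * Real.pi * Complex.I * β j) * ((√(m : ℝ))⁻¹ : ℝ))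
  have e1 : ∀ y : Fin k → ℝ, (limitGaussian k y : ℂ)
      * Complex.exp (∑ j, -(2 * Real.pi * Complex.I * β j) * ((√(m : ℝ))⁻¹ * y j : ℝ))
      = Complex.exp (-(b : ℂ) * ∑ j, (y j : ℂ) ^ 2
        + ∑ j, (-(2 * Real.pi * Complex.I * β j) * ((√(m : ℝ))⁻¹ : ℝ)) * y j) := by
    intro y
    rw [limitGaussian, Complex.exp_add, Complex.ofReal_exp]
    congr 2
    · push_cast [hb]; ring
    · exact Finset.sum_congr rfl fun j _ => by push_cast; ring
  simp only [e1]
  rw [h, gaussian, Complex.ofReal_div, div_eq_mul_inv, mul_comm]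
  congr 1
  · have e2 : (Real.pi : ℂ) / b = (((2 * Real.pi * sigmaSq k)⁻¹ : ℝ) : ℂ) := by
      rw [← Complex.ofReal_div]
      congr 1
      rw [hb]; field_simp
    rw [e2, ← Complex.ofReal_inv, ← Real.inv_rpow (by positivity),
      Complex.ofReal_cpow (by positivity)]
    simp
  · rw [Complex.ofReal_exp]
    congr 1
    have e3 : ∀ j, (-(2 * Real.pi * Complex.I * β j) * ((√(m : ℝ))⁻¹ : ℝ)) ^ 2
        = ((-(4 * Real.pi ^ 2 / m) * (β j : ℝ) ^ 2 : ℝ) : ℂ) := by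
      intro j
      have e4 : (((√(m : ℝ))⁻¹ : ℝ) : ℂ) ^ 2 = ((m : ℝ)⁻¹ : ℝ) := by
        rw [← Complex.ofReal_pow, inv_pow, Real.sq_sqrt hm'.le]
      rw [mul_pow, e4, neg_sq, mul_pow, mul_pow, mul_pow, Complex.I_sq]
      push_cast
      ring
    simp only [e3]
    have e5 : (4 : ℂ) * b = ((4 * b : ℝ) : ℂ) := by push_cast; ring
    rw [← Complex.ofReal_sum, ← Finset.mul_sum, e5, ← Complex.ofReal_div, hb]
    congr 1
    have := Real.pi_pos
    field_simp

theorem norm_cexp_sum_I (β : Fin k → ℤ) (x : Fin k → ℝ) :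
    ‖Complex.exp (∑ j, -(2 * Real.pi * Complex.I * β j) * (x j : ℂ))‖ = 1 := by
  have : (∑ j, -(2 * Real.pi * Complex.I * β j) * (x j : ℂ))
      = ((∑ j, -(2 * Real.pi * β j * x j) : ℝ) : ℂ) * Complex.I := by
    push_cast
    rw [Finset.sum_mul]
    exact Finset.sum_congr rfl fun j _ => by ring
  rw [this, Complex.norm_exp_ofReal_mul_I]

theorem integral_rescaled (β : Fin k → ℤ) {m : ℕ} (hm : m ≠ 0) :
    ∫ y : Fin k → ℝ, (rescaled k m y : ℂ)
      * Complex.exp (∑ j, -(2 * Real.pi * Complex.I * β j) * ((√(m : ℝ))⁻¹ * y j : ℝ))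
    = ((m : ℝ) ^ ((k : ℝ) / 2) / q k ^ m : ℝ) * ∫ x in unitCube k,
        ((posWeight (realCosSum x) * mainChar (k := k) m (realCosSum x) : ℝ) : ℂ)
          * Complex.exp (∑ j, -(2 * Real.pi * Complex.I * β j) * x j) := by
  have hm' : (0 : ℝ) < m := by exact_mod_cast Nat.pos_of_ne_zero hm
  have h := Measure.integral_comp_smul (volume : Measure (Fin k → ℝ))
    ((unitCube k).indicator fun x =>
      ((posWeight (realCosSum x) * mainChar (k := k) m (realCosSum x) / q k ^ m : ℝ) : ℂ)
          * Complex.exp (∑ j, -(2 * Real.pi * Complex.I * β j) * x j)) (√(m : ℝ))⁻¹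
  rw [integral_indicator measurableSet_unitCube] at h
  have e1 : |(((√(m : ℝ))⁻¹ ^ Module.finrank ℝ (Fin k → ℝ))⁻¹)| = (m : ℝ) ^ ((k : ℝ) / 2) := by
    rw [Module.finrank_fin_fun, inv_pow, inv_inv, abs_of_pos (by positivity), Real.sqrt_eq_rpow,
      ← Real.rpow_natCast, ← Real.rpow_mul hm'.le]
    congr 1; ring
  rw [e1] at h
  have e2 : ∀ y : Fin k → ℝ, (unitCube k).indicator (fun x =>
      ((posWeight (realCosSum x) * mainChar (k := k) m (realCosSum x) / q k ^ m : ℝ) : ℂ)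
          * Complex.exp (∑ j, -(2 * Real.pi * Complex.I * β j) * x j)) ((√(m : ℝ))⁻¹ • y)
      = (rescaled k m y : ℂ)
      * Complex.exp (∑ j, -(2 * Real.pi * Complex.I * β j) * ((√(m : ℝ))⁻¹ * y j : ℝ)) := by
    intro y
    by_cases hy : (√(m : ℝ))⁻¹ • y ∈ unitCube k
    · simp only [rescaled, Set.indicator_of_mem hy, Pi.smul_apply, smul_eq_mul]
    · simp only [rescaled, Set.indicator_of_notMem hy, Complex.ofReal_zero, zero_mul]
  simp only [e2] at h
  rw [h, Complex.real_smul, Complex.ofReal_div, div_mul_eq_mul_div, mul_div_assoc]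
  congr 1
  rw [← integral_div]
  congr 1
  ext x
  push_cast
  ring

theorem abs_s_le (m : ℕ) (β : Fin k → ℤ) : |s m β| ≤ 2 := by
  unfold s
  rcases Int.even_or_odd ((m : ℤ) + ∑ j, β j) with h | h
  · rw [h.neg_one_zpow]; norm_num
  · rw [h.neg_one_zpow]; norm_num

/-- Local limit theorem for cyclically reduced words of given length, with an error term that does
not depend on the vector of discrete logarithms. -/
theorem exists_local_limit (hk : 2 ≤ k) : ∃ e : ℕ → ℝ, Tendsto e atTop (𝓝 0) ∧
    ∀ m : ℕ, m ≠ 0 → ∀ β : Fin k → ℤ,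
      |(m : ℝ) ^ ((k : ℝ) / 2) * ((n β m : ℝ) / q k ^ m) - s m β * gaussian m β| ≤ e m := by
  have hk' : (2 : ℝ) ≤ k := by exact_mod_cast hk
  have hq := one_lt_q hk
  have hq0 : 0 < q k := by linarith
  -- The factor `2` bounds `|s m β|`. The last summand bounds the contribution of `(k - 1)(1 +
  -- (-1)^m)` at `β = 0`, with `m^(k/2)` relaxed to the natural power `m^k`.
  refine ⟨fun m => 2 * gaussianError k m + 2 * (k - 1) * ((m : ℝ) ^ k / q k ^ m), ?_, ?_⟩
  · have := ((tendsto_gaussianError hk).const_mul 2).add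
      ((tendsto_pow_const_div_const_pow_of_one_lt k hq).const_mul (2 * ((k : ℝ) - 1)))
    simpa using this
  intro m hm β
  have hm' : (1 : ℝ) ≤ m := by exact_mod_cast Nat.one_le_iff_ne_zero.mpr hm
  have hm0 : (0 : ℝ) < m := by linarith
  set E : (Fin k → ℝ) → ℂ := fun y =>
    Complex.exp (∑ j, -(2 * Real.pi * Complex.I * β j) * ((√(m : ℝ))⁻¹ * y j : ℝ)) with hE
  have hEn : ∀ y, ‖E y‖ = 1 := fun y => norm_cexp_sum_I β fun j => (√(m : ℝ))⁻¹ * y j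
  have hEc : Continuous E := by rw [hE]; fun_prop
  have hint : ∀ {f : (Fin k → ℝ) → ℝ}, Integrable f → Integrable fun y => (f y : ℂ) * E y :=
    fun hf => hf.ofReal.mul_bdd (c := 1) hEc.aestronglyMeasurable
      (Eventually.of_forall fun y => (hEn y).le)
  have hdiff : ‖(∫ y, (rescaled k m y : ℂ) * E y) - gaussian m β‖ ≤ gaussianError k m := by
    rw [gaussian_eq_integral hk hm, ← integral_sub (hint (integrable_rescaled hk hm))
      (hint (integrable_limitGaussian hk))]
    refine (norm_integral_le_integral_norm _).trans (le_of_eq ?_)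
    refine integral_congr_ae (Eventually.of_forall fun y => ?_)
    simp only [← sub_mul, norm_mul, hEn, mul_one, ← Complex.ofReal_sub, Complex.norm_real,
      Real.norm_eq_abs]
  have hmain : (((m : ℝ) ^ ((k : ℝ) / 2) * ((n β m : ℝ) / q k ^ m) - s m β * gaussian m β : ℝ) : ℂ)
      = s m β * ((∫ y, (rescaled k m y : ℂ) * E y) - gaussian m β)
        + (((m : ℝ) ^ ((k : ℝ) / 2) / q k ^ m * ((k - 1) * (1 + (-1) ^ m)
          * if β = 0 then 1 else 0) : ℝ) : ℂ) := by
    rw [integral_rescaled β hm]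
    have h := n_eq_setIntegral_add β m hm
    generalize (∫ x in unitCube k, ((posWeight (realCosSum x)
      * mainChar (k := k) m (realCosSum x) : ℝ) : ℂ)
      * Complex.exp (∑ j, -(2 * Real.pi * Complex.I * β j) * x j)) = I at h ⊢
    split_ifs at h ⊢ <;> push_cast <;> rw [h] <;> ring
  rw [← Real.norm_eq_abs, ← Complex.norm_real, hmain]
  refine (norm_add_le _ _).trans (add_le_add ?_ ?_)
  · rw [norm_mul, Complex.norm_real, Real.norm_eq_abs]
    exact mul_le_mul (abs_s_le m β) hdiff (norm_nonneg _) (by norm_num)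
  · rw [Complex.norm_real, norm_mul, Real.norm_eq_abs, Real.norm_eq_abs, mul_comm]
    have h1 : |(m : ℝ) ^ ((k : ℝ) / 2) / q k ^ m| ≤ (m : ℝ) ^ k / q k ^ m := by
      rw [abs_of_nonneg (by positivity)]
      gcongr
      rw [← Real.rpow_natCast]
      exact Real.rpow_le_rpow_of_exponent_le hm' (by linarith)
    have h2 : |(k - 1 : ℝ) * (1 + (-1) ^ m) * if β = 0 then 1 else 0| ≤ 2 * (k - 1) := by
      have h3 : |(1 : ℝ) + (-1) ^ m| ≤ 2 := by
        rcases neg_one_pow_eq_or ℝ m with h | h <;> rw [h] <;> norm_num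
      have h4 : |if β = 0 then (1 : ℝ) else 0| ≤ 1 := by split_ifs <;> norm_num
      rw [abs_mul, abs_mul, abs_of_nonneg (by linarith : (0 : ℝ) ≤ k - 1)]
      calc ((k : ℝ) - 1) * |(1 : ℝ) + (-1) ^ m| * |if β = 0 then (1 : ℝ) else 0|
          ≤ ((k : ℝ) - 1) * 2 * 1 := by
            have : (0 : ℝ) ≤ k - 1 := by linarith
            gcongr
        _ = _ := by ring
    exact mul_le_mul h2 h1 (abs_nonneg _) (by linarith)

end FreeGroupCount

/-! ### From words of fixed length to words of bounded length -/

namespace FreeGroupCount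

open Filter Topology

variable {k : ℕ}

/-- A family of sequences that satisfies a perturbed contraction inequality tends to zero
uniformly. -/
theorem eventually_le_of_contraction {ι : Type*} {e : ℕ → ι → ℝ} {δ : ℕ → ℝ} {r : ℝ}
    (hr0 : 0 ≤ r) (hr1 : r < 1) (hδ : Tendsto δ atTop (𝓝 0))
    (hb : ∀ m, ∃ C, ∀ i, e m i ≤ C)
    (hstep : ∀ᶠ m in atTop, ∀ i, e (m + 1) i ≤ r * e m i + δ m) {ε : ℝ} (hε : 0 < ε) :
    ∀ᶠ m in atTop, ∀ i, e m i ≤ ε := by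
  have hr : 0 < 1 - r := by linarith
  -- The threshold makes `ε / 2` stable: `r (ε / 2) + (ε / 2)(1 - r) = ε / 2`.
  obtain ⟨M, hM⟩ := eventually_atTop.mp
    (hstep.and (hδ.eventually_lt_const (show 0 < (ε / 2) * (1 - r) by positivity)))
  obtain ⟨C, hC⟩ := hb M
  have hind : ∀ j i, e (M + j) i ≤ r ^ j * |C| + ε / 2 := by
    intro j i
    induction j with
    | zero => simpa using (hC i).trans ((le_abs_self C).trans (by linarith))
    | succ j ih =>
      obtain ⟨h1, h2⟩ := hM (M + j) (by omega)
      have h3 := h1 i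
      have h4 := mul_le_mul_of_nonneg_left ih hr0
      rw [← add_assoc, pow_succ]
      linarith
  have hpow : Tendsto (fun j : ℕ => r ^ j * |C|) atTop (𝓝 0) := by
    simpa using (tendsto_pow_atTop_nhds_zero_of_lt_one hr0 hr1).mul_const |C|
  obtain ⟨J, hJ⟩ := eventually_atTop.mp (hpow.eventually_lt_const (half_pos hε))
  filter_upwards [eventually_ge_atTop (M + J)] with m hm i
  obtain ⟨j, rfl⟩ := Nat.exists_eq_add_of_le (show M ≤ m by omega)
  have := hind j i
  have := hJ j (by omega)
  linarith

theorem N_add_one (β : Fin k → ℤ) (m : ℕ) : N β (m + 1) = N β m + n β (m + 1) := by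
  have hfin : ∀ P : FreeGroup (Fin k) → Prop, ∀ m : ℕ, (∀ γ, P γ → γ.norm ≤ m) →
      {γ | P γ}.Finite := fun P m h => (finite_norm_le k m).subset h
  rw [N, N, n, ← Set.ncard_union_eq ?_
    (hfin (fun γ => γ ∈ cyclicallyReduced k ∧ γ.norm ≤ m ∧ Phi γ = β) m fun γ h => h.2.1)
    (hfin (fun γ => γ ∈ cyclicallyReduced k ∧ γ.norm = m + 1 ∧ Phi γ = β) (m + 1)
      fun γ h => h.2.1.le)]
  · congr 1
    ext γ
    simp only [Set.mem_ofPred_eq, Set.mem_union, Nat.le_succ_iff]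
    tauto
  · rw [Set.disjoint_left]
    rintro γ ⟨_, h, _⟩ ⟨_, h', _⟩
    omega

theorem N_le (m : ℕ) : ∃ C : ℝ, ∀ β : Fin k → ℤ, (N β m : ℝ) ≤ C :=
  ⟨({γ : FreeGroup (Fin k) | γ.norm ≤ m}.ncard : ℝ), fun β => by
    have h : {γ | γ ∈ cyclicallyReduced k ∧ γ.norm ≤ m ∧ Phi γ = β}
        ⊆ {γ : FreeGroup (Fin k) | γ.norm ≤ m} := fun γ h => h.2.1
    exact_mod_cast Set.ncard_le_ncard h (finite_norm_le k m)⟩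

theorem s_add_s (m : ℕ) (β : Fin k → ℤ) : s m β + s (m + 1) β = 2 := by
  unfold s
  rw [show ((m + 1 : ℕ) : ℤ) + ∑ j, β j = ((m : ℤ) + ∑ j, β j) + 1 by push_cast; ring,
    zpow_add_one₀ (by norm_num)]
  ring

/-- The peak height of the Gaussian term. -/
noncomputable def gaussianPeak (k : ℕ) : ℝ := ((2 * Real.pi * sigmaSq k) ^ ((k : ℝ) / 2))⁻¹

theorem gaussianPeak_pos (hk : 2 ≤ k) : 0 < gaussianPeak k := by
  have := sigmaSq_pos hk
  unfold gaussianPeak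
  positivity

theorem gaussian_eq (m : ℕ) (β : Fin k → ℤ) : gaussian m β
    = gaussianPeak k * Real.exp (-((∑ j, (β j : ℝ) ^ 2) / (2 * sigmaSq k) / m)) := by
  rw [gaussian, gaussianPeak, div_eq_inv_mul, div_div, neg_div]

theorem gaussian_nonneg (hk : 2 ≤ k) (m : ℕ) (β : Fin k → ℤ) : 0 ≤ gaussian m β := by
  rw [gaussian_eq]
  have := gaussianPeak_pos hk
  positivity

theorem gaussian_le (hk : 2 ≤ k) (m : ℕ) (β : Fin k → ℤ) : gaussian m β ≤ gaussianPeak k := by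
  rw [gaussian_eq]
  have h := sigmaSq_pos hk
  refine mul_le_of_le_one_right (gaussianPeak_pos hk).le (Real.exp_le_one_iff.mpr ?_)
  rw [neg_nonpos]
  positivity

/-- For `y = x / (m + 1)` one has `x / m = y + y / m`, so the difference is at most `e^(-y) y / m`.
Since `y e^(-y) ≤ 1`, the bound is uniform in `x`, hence in `β`. -/
theorem abs_exp_neg_div_sub_le {x : ℝ} (hx : 0 ≤ x) {m : ℕ} (hm : m ≠ 0) :
    |Real.exp (-(x / (m + 1 : ℕ))) - Real.exp (-(x / m))| ≤ 1 / m := by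
  have hm' : (0 : ℝ) < m := by exact_mod_cast Nat.pos_of_ne_zero hm
  set y : ℝ := x / (m + 1 : ℕ) with hy
  have hy0 : 0 ≤ y := by positivity
  have e1 : -(x / m) = -y + -(y / m) := by
    rw [hy]; push_cast; field_simp; ring
  rw [e1, Real.exp_add, ← mul_one_sub, abs_mul, abs_of_pos (Real.exp_pos _)]
  have h1 : 1 - y / m ≤ Real.exp (-(y / m)) := Real.one_sub_le_exp_neg _
  have h2 : Real.exp (-(y / m)) ≤ 1 := Real.exp_le_one_iff.mpr (by rw [neg_nonpos]; positivity)
  have h3 : Real.exp (-y) * y ≤ 1 := by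
    have := Real.add_one_le_exp y
    rw [Real.exp_neg, inv_mul_le_iff₀ (Real.exp_pos _)]
    linarith
  rw [abs_of_nonneg (by linarith)]
  calc Real.exp (-y) * (1 - Real.exp (-(y / m))) ≤ Real.exp (-y) * (y / m) := by
        gcongr; linarith
    _ = Real.exp (-y) * y / m := by ring
    _ ≤ 1 / m := by gcongr

theorem abs_gaussian_sub_le (hk : 2 ≤ k) {m : ℕ} (hm : m ≠ 0) (β : Fin k → ℤ) :
    |gaussian (m + 1) β - gaussian m β| ≤ gaussianPeak k * (1 / m) := by
  have hσ := sigmaSq_pos hk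
  rw [gaussian_eq, gaussian_eq, ← mul_sub, abs_mul, abs_of_pos (gaussianPeak_pos hk)]
  exact mul_le_mul_of_nonneg_left (abs_exp_neg_div_sub_le (by positivity) hm)
    (gaussianPeak_pos hk).le

theorem tendsto_succ_div_rpow (k : ℕ) :
    Tendsto (fun m : ℕ => (((m + 1 : ℕ) : ℝ) / m) ^ ((k : ℝ) / 2)) atTop (𝓝 1) := by
  have h : Tendsto (fun m : ℕ => ((m + 1 : ℕ) : ℝ) / m) atTop (𝓝 1) := by
    have h1 := tendsto_inv_atTop_nhds_zero_nat (𝕜 := ℝ).const_add 1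
    rw [add_zero] at h1
    refine h1.congr' ?_
    filter_upwards [eventually_ne_atTop 0] with m hm
    have : (m : ℝ) ≠ 0 := by exact_mod_cast hm
    push_cast
    field_simp
  simpa using h.rpow_const (p := (k : ℝ) / 2) (Or.inl one_ne_zero)

/-- The normalised, parity-averaged summatory counting function. -/
noncomputable def averaged (β : Fin k → ℤ) (m : ℕ) : ℝ :=
  (m : ℝ) ^ ((k : ℝ) / 2) / 2 *
    ((N β m : ℝ) / (q k ^ (m + 1) / (q k - 1)) + (N β (m + 1) : ℝ) / (q k ^ (m + 2) / (q k - 1)))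

/-- The normalised counting function. -/
noncomputable def normalized (β : Fin k → ℤ) (m : ℕ) : ℝ :=
  (m : ℝ) ^ ((k : ℝ) / 2) * ((n β m : ℝ) / q k ^ m)

theorem averaged_add_one (hk : 2 ≤ k) (β : Fin k → ℤ) {m : ℕ} (hm : m ≠ 0) :
    averaged β (m + 1) = (q k)⁻¹ * (((m + 1 : ℕ) : ℝ) / m) ^ ((k : ℝ) / 2) * averaged β m
      + (1 - (q k)⁻¹) / 2 * (normalized β (m + 1)
        + ((((m + 2 : ℕ) : ℝ) / (m + 1 : ℕ)) ^ ((k : ℝ) / 2))⁻¹ * normalized β (m + 2)) := by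
  have hq := one_lt_q hk
  have hq0 : q k ≠ 0 := by linarith
  have hq1 : q k - 1 ≠ 0 := by linarith
  have hm0 : (0 : ℝ) < m := by exact_mod_cast Nat.pos_of_ne_zero hm
  rw [averaged, averaged, normalized, normalized, N_add_one β (m + 1), N_add_one β m,
    Real.div_rpow (by positivity) (by positivity), Real.div_rpow (by positivity) (by positivity)]
  have h0 : (m : ℝ) ^ ((k : ℝ) / 2) ≠ 0 := by positivity
  have h1 : ((m + 1 : ℕ) : ℝ) ^ ((k : ℝ) / 2) ≠ 0 := by positivity
  have h2 : ((m + 2 : ℕ) : ℝ) ^ ((k : ℝ) / 2) ≠ 0 := by positivity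
  generalize (m : ℝ) ^ ((k : ℝ) / 2) = a at *
  generalize ((m + 1 : ℕ) : ℝ) ^ ((k : ℝ) / 2) = b at *
  generalize ((m + 2 : ℕ) : ℝ) ^ ((k : ℝ) / 2) = c at *
  push_cast
  field_simp
  ring

/-- In `ENNReal` an unbounded family has supremum `⊤`, not the default value `0` of a real supremum,
so no boundedness has to be shown separately. -/
theorem tendsto_iSup_ofReal_abs {ι : Type*} {f : ℕ → ι → ℝ}
    (h : ∀ ε > 0, ∀ᶠ m in atTop, ∀ i, |f m i| ≤ ε) :
    Tendsto (fun m => ⨆ i, ENNReal.ofReal |f m i|) atTop (𝓝 0) := by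
  rw [ENNReal.tendsto_nhds_zero]
  intro ε hε
  obtain ⟨δ, hδ0, hδ⟩ : ∃ δ : ℝ, 0 < δ ∧ ENNReal.ofReal δ ≤ ε := by
    rcases eq_or_ne ε ⊤ with rfl | htop
    · exact ⟨1, one_pos, le_top⟩
    · exact ⟨ε.toReal, ENNReal.toReal_pos hε.ne' htop, ENNReal.ofReal_toReal_le⟩
  filter_upwards [h δ hδ0] with m hm
  exact iSup_le fun i => (ENNReal.ofReal_le_ofReal (hm i)).trans hδ

theorem eventually_abs_averaged_sub_le (hk : 2 ≤ k) {ε : ℝ} (hε : 0 < ε) :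
    ∀ᶠ m in atTop, ∀ β : Fin k → ℤ, |averaged β m - gaussian m β| ≤ ε := by
  have hq := one_lt_q hk
  have hq0 : 0 < q k := by linarith
  obtain ⟨e, he, hloc⟩ := exists_local_limit hk
  set ρ : ℕ → ℝ := fun m => (((m + 1 : ℕ) : ℝ) / m) ^ ((k : ℝ) / 2) with hρ
  have hρ1 : Tendsto ρ atTop (𝓝 1) := tendsto_succ_div_rpow k
  have hρ2 : Tendsto (fun m => (ρ (m + 1))⁻¹) atTop (𝓝 1) := by
    simpa using (hρ1.comp (tendsto_add_atTop_nat 1)).inv₀ one_ne_zero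
  set G := gaussianPeak k with hG
  have hG0 : 0 < G := gaussianPeak_pos hk
  have hqi : (q k)⁻¹ < 1 := inv_lt_one_of_one_lt₀ hq
  have hqi0 : 0 < (q k)⁻¹ := inv_pos.mpr hq0
  -- The recursion factor `(q k)⁻¹ * ρ m` tends to `(q k)⁻¹`, so it is eventually below `r`.
  obtain ⟨r, hr1, hr2⟩ := exists_between hqi
  set δ : ℕ → ℝ := fun m => |ρ m - 1| * G + G * (1 / m)
    + (|e (m + 1)| + |(ρ (m + 1))⁻¹| * |e (m + 2)| + |(ρ (m + 1))⁻¹ - 1| * (2 * G)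
      + 2 * (G * (1 / (m + 1 : ℕ)))) with hδ
  have hinv : Tendsto (fun m : ℕ => G * (1 / (m : ℝ))) atTop (𝓝 0) := by
    simpa using (tendsto_inv_atTop_nhds_zero_nat (𝕜 := ℝ)).const_mul G
  have hδ0 : Tendsto δ atTop (𝓝 0) := by
    have h1 := ((hρ1.sub_const 1).abs.mul_const G).add hinv
    have h2 := (he.comp (tendsto_add_atTop_nat 1)).abs
    have h3 := hρ2.abs.mul (he.comp (tendsto_add_atTop_nat 2)).abs
    have h4 := (hρ2.sub_const 1).abs.mul_const (2 * G)
    have h5 := (hinv.comp (tendsto_add_atTop_nat 1)).const_mul 2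
    simpa [hδ] using h1.add (((h2.add h3).add h4).add h5)
  refine eventually_le_of_contraction (e := fun m β => |averaged β m - gaussian m β|)
    (hqi0.trans hr1).le hr2 hδ0 ?_ ?_ hε
  · intro m
    obtain ⟨C, hC⟩ := N_le (k := k) m
    obtain ⟨C', hC'⟩ := N_le (k := k) (m + 1)
    have hq1 : 0 < q k - 1 := by linarith
    refine ⟨(m : ℝ) ^ ((k : ℝ) / 2) / 2 *
      (C / (q k ^ (m + 1) / (q k - 1)) + C' / (q k ^ (m + 2) / (q k - 1))) + G, fun β => ?_⟩
    refine (abs_sub _ _).trans (add_le_add ?_ ?_)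
    · rw [averaged, abs_of_nonneg (by positivity)]
      gcongr
      · exact hC β
      · exact hC' β
    · rw [abs_of_nonneg (gaussian_nonneg hk m β)]
      exact gaussian_le hk m β
  · have hρr : ∀ᶠ m in atTop, (q k)⁻¹ * ρ m < r := by
      have := hρ1.const_mul (q k)⁻¹
      rw [mul_one] at this
      exact this.eventually_lt_const hr1
    filter_upwards [hρr, eventually_ne_atTop 0] with m hmr hm β
    have hρ0 : 0 ≤ ρ m := by rw [hρ]; positivity
    set X := averaged β m - gaussian m β with hX
    set u := normalized β (m + 1) - s (m + 1) β * gaussian (m + 1) β with hu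
    set v := normalized β (m + 2) - s (m + 2) β * gaussian (m + 2) β with hv
    have hub : |u| ≤ |e (m + 1)| := (hloc _ (by omega) β).trans (le_abs_self _)
    have hvb : |v| ≤ |e (m + 2)| := (hloc _ (by omega) β).trans (le_abs_self _)
    set d := gaussian (m + 1) β - gaussian m β with hd
    set d' := gaussian (m + 2) β - gaussian (m + 1) β with hd'
    have hdb : |d| ≤ G * (1 / m) := abs_gaussian_sub_le hk hm β
    have hdb' : |d'| ≤ G * (1 / (m + 1 : ℕ)) := abs_gaussian_sub_le hk (Nat.succ_ne_zero m) β
    have hs : s (m + 1) β + s (m + 2) β = 2 := s_add_s (m + 1) β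
    have hsb : |s (m + 2) β| ≤ 2 := abs_s_le _ β
    have hg : |gaussian m β| ≤ G := by
      rw [abs_of_nonneg (gaussian_nonneg hk m β)]; exact gaussian_le hk m β
    have hg' : |gaussian (m + 2) β| ≤ G := by
      rw [abs_of_nonneg (gaussian_nonneg hk _ β)]; exact gaussian_le hk _ β
    set τ := (ρ (m + 1))⁻¹ with hτ
    set p := (q k)⁻¹ with hp
    have hstep : averaged β (m + 1) - gaussian (m + 1) β = p * ρ m * X
        + p * ((ρ m - 1) * gaussian m β - d)
        + (1 - p) / 2 * (u + τ * v + (τ - 1) * (s (m + 2) β * gaussian (m + 2) β)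
          + s (m + 2) β * d') := by
      have h := averaged_add_one hk β hm
      change _ = p * ρ m * averaged β m + (1 - p) / 2 * (_ + τ * _) at h
      rw [h, hX, hu, hv, hd, hd']
      linear_combination (1 - p) / 2 * gaussian (m + 1) β * hs
    have hA : |p * ρ m * X| ≤ r * |X| := by
      rw [abs_mul, abs_of_nonneg (by positivity)]
      gcongr
    have hB : |p * ((ρ m - 1) * gaussian m β - d)| ≤ |ρ m - 1| * G + G * (1 / m) := by
      rw [abs_mul, abs_of_pos hqi0]
      refine (mul_le_of_le_one_left (abs_nonneg _) hqi.le).trans ((abs_sub _ _).trans ?_)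
      rw [abs_mul]
      gcongr
    have hC : |(1 - p) / 2 * (u + τ * v + (τ - 1) * (s (m + 2) β * gaussian (m + 2) β)
          + s (m + 2) β * d')| ≤ |e (m + 1)| + |τ| * |e (m + 2)| + |τ - 1| * (2 * G)
            + 2 * (G * (1 / (m + 1 : ℕ))) := by
      rw [abs_mul, abs_of_nonneg (by linarith : (0 : ℝ) ≤ (1 - p) / 2)]
      refine (mul_le_of_le_one_left (abs_nonneg _) (by linarith)).trans ?_
      refine (abs_add_le _ _).trans (add_le_add ((abs_add_le _ _).trans (add_le_add
        ((abs_add_le _ _).trans (add_le_add hub ?_)) ?_)) ?_)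
      · rw [abs_mul]; gcongr
      · rw [abs_mul, abs_mul]; gcongr
      · rw [abs_mul]; gcongr
    change |averaged β (m + 1) - gaussian (m + 1) β| ≤ r * |X| + δ m
    rw [hstep]
    refine (abs_add_le _ _).trans ((add_le_add ((abs_add_le _ _).trans (add_le_add hA hB))
      hC).trans (le_of_eq ?_))
    rw [add_assoc]

end FreeGroupCount

theorem theorem3p7 (k : ℕ) (hk : 2 ≤ k) :
    Filter.Tendsto
      (fun m : ℕ => ⨆ β : Fin k → ℤ, ENNReal.ofReal
        |(m : ℝ) ^ ((k : ℝ) / 2) * ((FreeGroupCount.n β m : ℝ) / FreeGroupCount.q k ^ m)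
          - FreeGroupCount.s m β * FreeGroupCount.gaussian m β|)
      Filter.atTop (nhds 0)
    ∧
    Filter.Tendsto
      (fun m : ℕ => ⨆ β : Fin k → ℤ, ENNReal.ofReal
        |(m : ℝ) ^ ((k : ℝ) / 2) / 2 *
            ((FreeGroupCount.N β m : ℝ)
                / (FreeGroupCount.q k ^ (m + 1) / (FreeGroupCount.q k - 1))
              + (FreeGroupCount.N β (m + 1) : ℝ)
                / (FreeGroupCount.q k ^ (m + 2) / (FreeGroupCount.q k - 1)))
          - FreeGroupCount.gaussian m β|)
      Filter.atTop (nhds 0) := by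
  refine ⟨FreeGroupCount.tendsto_iSup_ofReal_abs fun ε hε => ?_,
    FreeGroupCount.tendsto_iSup_ofReal_abs fun ε hε =>
      FreeGroupCount.eventually_abs_averaged_sub_le hk hε⟩
  obtain ⟨e, he, hloc⟩ := FreeGroupCount.exists_local_limit hk
  filter_upwards [he.eventually_lt_const hε, Filter.eventually_ne_atTop 0] with m hm hm0 β
  exact (hloc m hm0 β).trans hm.le
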